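/- Let $k\ge 1$ be an integer, let $\chi$ be a Dirichlet character modulo $N\ge 1$ (not necessarily primitive), and let $\chi_0$ be the trivial character of conductor $1$, so $\chi_0(n)=1$ for all $n$. For Dirichlet characters $\psi_1,\psi_2$ put $$L_2^{\ast}(s_1,s_2;\psi_1,\psi_2)=\sum_{1\le m_1<m_2}\frac{\psi_1(m_1)\psi_2(m_2)}{m_1^{s_1}m_2^{s_2}}=\sum_{m,n\ge 1}\frac{\psi_1(m)\psi_2(m+n)}{m^{s_1}(m+n)^{s_2}},$$ $$L_2^{\mathrm{sh}}(s_1,s_2;\psi_1,\psi_2)=\sum_{1\le m_1<m_2}\frac{\psi_1(m_1)\psi_2(m_2-m_1)}{m_1^{s_1}m_2^{s_2}}=\sum_{m,n\ge 1}\frac{\psi_1(m)\psi_2(n)}{m^{s_1}(m+n)^{s_2}},$$ and let $L(s;\chi)=\sum_{n\ge 1}\chi(n)n^{-s}$ and $\zeta_2(k_1,k_2)=\sum_{1\le m_1<m_2}m_1^{-k_1}m_2^{-k_2}=\sum_{m,n\ge 1}m^{-k_1}(m+n)^{-k_2}$. Then all the series below converge absolutely, and $$\sum_{\nu=2}^{k+1}\nu\,L_2^{\mathrm{sh}}(k+2-\nu,\nu+1;\chi,\chi_0)+(k+1)L_2^{\mathrm{sh}}(1,k+2;\chi_0,\chi)+L_2^{\mathrm{sh}}(2,k+1;\chi_0,\chi)-L_2^{\ast}(2,k+1;\chi_0,\chi)=L(k+3;\chi).$$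 In particular, with $\zeta$ the Riemann zeta function and an empty sum understood as $0$, $$\sum_{\nu=2}^{k}\nu\,\zeta_2(k+2-\nu,\nu+1)+2(k+1)\,\zeta_2(1,k+2)=\zeta(k+3).$$ -/

import Mathlib

open Finset

noncomputable section

/-- The general term, indexed by pairs `(m, n)` of positive integers, of the double zeta value
`ζ₂(k₁, k₂)`: the pair `(m, n)` stands for `m₁ = m < m₂ = m + n`. -/
def zeta2Term (k₁ k₂ : ℕ) (p : ℕ+ × ℕ+) : ℂ :=
  1 / (((p.1 : ℕ) : ℂ) ^ k₁ * (((p.1 : ℕ) : ℂ) + ((p.2 : ℕ) : ℂ)) ^ k₂)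

/-- The double zeta value
`ζ₂(k₁, k₂) = ∑_{1 ≤ m₁ < m₂} m₁^{-k₁} m₂^{-k₂} = ∑_{m, n ≥ 1} m^{-k₁} (m + n)^{-k₂}`. -/
def zeta2 (k₁ k₂ : ℕ) : ℂ := ∑' p : ℕ+ × ℕ+, zeta2Term k₁ k₂ p

/-- The general term `ψ₁(m) ψ₂(n) m^{-s₁} (m + n)^{-s₂}` of the shuffle-type double `L`-series;
the pair `(m, n)` stands for `m₁ = m < m₂ = m + n`, so that `n = m₂ - m₁`. -/
def L2shTerm {M N : ℕ} (s₁ s₂ : ℂ) (ψ₁ : DirichletCharacter ℂ M) (ψ₂ : DirichletCharacter ℂ N)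
    (p : ℕ+ × ℕ+) : ℂ :=
  ψ₁ ((p.1 : ℕ) : ZMod M) * ψ₂ ((p.2 : ℕ) : ZMod N) /
    (((p.1 : ℕ) : ℂ) ^ s₁ * (((p.1 : ℕ) : ℂ) + ((p.2 : ℕ) : ℂ)) ^ s₂)

/-- The double `L`-function of shuffle type,
`∑_{1 ≤ m₁ < m₂} ψ₁(m₁) ψ₂(m₂ - m₁) m₁^{-s₁} m₂^{-s₂}`. -/
def L2sh {M N : ℕ} (s₁ s₂ : ℂ) (ψ₁ : DirichletCharacter ℂ M) (ψ₂ : DirichletCharacter ℂ N) : ℂ :=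
  ∑' p : ℕ+ × ℕ+, L2shTerm s₁ s₂ ψ₁ ψ₂ p

/-- The general term `ψ₁(m) ψ₂(m + n) m^{-s₁} (m + n)^{-s₂}` of the harmonic-type double
`L`-series; the pair `(m, n)` stands for `m₁ = m < m₂ = m + n`. -/
def L2astTerm {M N : ℕ} (s₁ s₂ : ℂ) (ψ₁ : DirichletCharacter ℂ M) (ψ₂ : DirichletCharacter ℂ N)
    (p : ℕ+ × ℕ+) : ℂ :=
  ψ₁ ((p.1 : ℕ) : ZMod M) * ψ₂ (((p.1 : ℕ) + (p.2 : ℕ) : ℕ) : ZMod N) /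
    (((p.1 : ℕ) : ℂ) ^ s₁ * (((p.1 : ℕ) : ℂ) + ((p.2 : ℕ) : ℂ)) ^ s₂)

/-- The double `L`-function of harmonic type,
`∑_{1 ≤ m₁ < m₂} ψ₁(m₁) ψ₂(m₂) m₁^{-s₁} m₂^{-s₂}`. -/
def L2ast {M N : ℕ} (s₁ s₂ : ℂ) (ψ₁ : DirichletCharacter ℂ M) (ψ₂ : DirichletCharacter ℂ N) : ℂ :=
  ∑' p : ℕ+ × ℕ+, L2astTerm s₁ s₂ ψ₁ ψ₂ p

/-- The trivial character `χ₀`, of conductor `1`: it takes the value `1` at every integer. -/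
def trivChar : DirichletCharacter ℂ 1 := 1

end

/-!
Write `z = x + y`. Differentiating in `y` the partial fraction expansion
`1 / (y z ^ (k + 1)) = 1 / (x ^ (k + 1) y) - ∑ ν ∈ [1, k + 1], 1 / (x ^ (k + 2 - ν) z ^ ν)`
gives the rational identity `sum_partial_fractions`:
`∑ ν ∈ [2, k + 1], ν / (x ^ (k + 2 - ν) z ^ (ν + 1)) + (k + 1) / (y z ^ (k + 2))
  + 1 / (y ^ 2 z ^ (k + 1)) = 1 / (x ^ (k + 1) y ^ 2) - 1 / (x ^ (k + 1) z ^ 2)`.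
Multiply it by `f x`, where `f` is any bounded function, and sum over all pairs `(x, y)` of positive
integers. The left-hand side becomes the three shuffle-type sums (in the last two, `x` is the second
summation variable). On the right, the sum of `f x / (x ^ (k + 1) y ^ 2)` is split according to
`x > y`, `x < y` and `x = y` (`tsum_pnat_prod_eq`): the first part is the harmonic-type sum, the
second cancels the sum of `f x / (x ^ (k + 1) z ^ 2)`, and the diagonal is `∑ f n / n ^ (k + 3)`.
Neither multiplicativity nor periodicity of the character plays a role, only its boundedness
(`sum_formula_of_bounded`). Everything converges absolutely since
`m (m + n) ^ 2 ≥ m ^ (3 / 2) n ^ (3 / 2)` (`summable_zeta2Term`).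

The formula for double zeta values is the case of the character modulo `1`: the shuffle-type and
harmonic-type sums at `(2, k + 1)` then agree, and the term `ν = k + 1` of the sum is
`(k + 1) ζ₂(1, k + 2)`.
-/

/-! ### The partial fraction identity -/

/-- The `y`-derivative of the partial fraction expansion of `1 / (y (x + y) ^ (k + 1))`, with
the sign changed and the terms `ν ≥ 2` brought to the left. It is proved by induction on `k`. -/
theorem sum_partial_fractions (k : ℕ) {x y : ℂ} (hx : x ≠ 0) (hy : y ≠ 0) (hz : x + y ≠ 0) :
    ∑ ν ∈ Icc 2 (k + 1), (ν : ℂ) * (1 / (x ^ (k + 2 - ν) * (x + y) ^ (ν + 1)))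
      + (k + 1) * (1 / (y ^ 1 * (y + x) ^ (k + 2))) + 1 / (y ^ 2 * (y + x) ^ (k + 1))
      = 1 / (x ^ (k + 1) * y ^ 2) - 1 / (x ^ (k + 1) * (x + y) ^ 2) := by
  rw [add_comm y x]
  induction k with
  | zero =>
    simp only [zero_add, Nat.cast_zero, show Icc 2 1 = (∅ : Finset ℕ) from rfl, sum_empty]
    field_simp
    ring
  | succ k ih =>
    -- all terms but the last of the new sum are those of the old one divided by `x`
    have hsum : ∑ ν ∈ Icc 2 (k + 1), (ν : ℂ) * (1 / (x ^ (k + 1 + 2 - ν) * (x + y) ^ (ν + 1)))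
        = (∑ ν ∈ Icc 2 (k + 1), (ν : ℂ) * (1 / (x ^ (k + 2 - ν) * (x + y) ^ (ν + 1)))) / x := by
      rw [sum_div]
      refine sum_congr rfl fun ν hν => ?_
      rw [show k + 1 + 2 - ν = (k + 2 - ν) + 1 by have := mem_Icc.1 hν; omega, pow_succ]
      field_simp
    rw [sum_Icc_succ_top (by omega), hsum, eq_sub_of_add_eq (eq_sub_of_add_eq ih),
      show k + 1 + 2 - (k + 1 + 1) = 1 by omega]
    push_cast
    field_simp
    ring

/-! ### Absolute convergence -/

theorem summable_zeta2Term {a b : ℕ} (ha : 1 ≤ a) (hb : 2 ≤ b) : Summable (zeta2Term a b) := by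
  have h1 : Summable fun n : ℕ+ => 1 / ((n : ℕ) : ℝ) ^ (3 / 2 : ℝ) :=
    (Real.summable_one_div_nat_rpow.2 (by norm_num)).comp_injective PNat.coe_injective
  refine Summable.of_norm_bounded
    (h1.mul_of_nonneg h1 (fun _ => by positivity) (fun _ => by positivity)) ?_
  rintro ⟨m, n⟩
  have hm : (1 : ℝ) ≤ (m : ℕ) := by exact_mod_cast m.2
  have hn : (1 : ℝ) ≤ (n : ℕ) := by exact_mod_cast n.2
  have hnorm : ‖zeta2Term a b (m, n)‖
      = 1 / (((m : ℕ) : ℝ) ^ a * (((m : ℕ) : ℝ) + ((n : ℕ) : ℝ)) ^ b) := by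
    rw [zeta2Term, norm_div, norm_mul, norm_pow, norm_pow, ← Nat.cast_add,
      Complex.norm_natCast, Complex.norm_natCast, norm_one, Nat.cast_add]
  simp only [hnorm, one_div_mul_one_div]
  generalize ((m : ℕ) : ℝ) = x at *
  generalize ((n : ℕ) : ℝ) = y at *
  have hx : 0 < x := by linarith
  have hy : 0 < y := by linarith
  apply one_div_le_one_div_of_le (by positivity)
  have hsqrt : √(x * y) ≤ x + y := Real.sqrt_le_iff.2 ⟨by positivity, by nlinarith⟩
  calc x ^ (3 / 2 : ℝ) * y ^ (3 / 2 : ℝ) = (x * y) * √(x * y) := by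
        rw [← Real.mul_rpow hx.le hy.le, Real.sqrt_eq_rpow, show (3 / 2 : ℝ) = 1 + 1 / 2 by norm_num,
          Real.rpow_add (by positivity), Real.rpow_one]
    _ ≤ (x * (x + y)) * (x + y) := by gcongr; linarith
    _ = x ^ 1 * (x + y) ^ 2 := by ring
    _ ≤ x ^ a * (x + y) ^ b := by
        gcongr
        linarith

theorem Summable.bounded_mul {ι : Type*} {g u : ι → ℂ} (hg : Summable g) {C : ℝ}
    (hu : ∀ i, ‖u i‖ ≤ C) : Summable fun i => u i * g i :=
  Summable.of_norm_bounded (hg.norm.mul_left C) fun i => by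
    rw [norm_mul]
    exact mul_le_mul_of_nonneg_right (hu i) (norm_nonneg _)

/-! ### The harmonic product decomposition -/

/-- The positive quadrant is the disjoint union of the pairs below, above and on the diagonal. -/
def pnatProdSplit : (ℕ+ × ℕ+) ⊕ ((ℕ+ × ℕ+) ⊕ ℕ+) → ℕ+ × ℕ+ :=
  Sum.elim (fun p => (p.1 + p.2, p.1)) (Sum.elim (fun p => (p.1, p.1 + p.2)) fun n => (n, n))

theorem pnatProdSplit_bijective : Function.Bijective pnatProdSplit := by
  constructor
  · rintro (⟨a, b⟩ | ⟨a, b⟩ | a) (⟨c, d⟩ | ⟨c, d⟩ | c) h <;>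
      simp only [pnatProdSplit, Sum.elim_inl, Sum.elim_inr, Prod.mk.injEq, ← PNat.coe_inj,
        PNat.add_coe] at h <;>
      simp only [Sum.inl.injEq, Sum.inr.injEq, Prod.mk.injEq, reduceCtorEq, ← PNat.coe_inj] <;>
      first
        | omega
        | (have := b.pos; omega)
        | (have := d.pos; omega)
  · rintro ⟨a, b⟩
    rcases lt_trichotomy a b with h | rfl | h
    · exact ⟨Sum.inr (Sum.inl (a, b - a)), Prod.ext rfl (PNat.add_sub_of_lt h)⟩
    · exact ⟨Sum.inr (Sum.inr a), rfl⟩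
    · exact ⟨Sum.inl (b, a - b), Prod.ext (PNat.add_sub_of_lt h) rfl⟩

theorem tsum_pnat_prod_eq {G : ℕ+ × ℕ+ → ℂ} (hG : Summable G) :
    ∑' p, G p = ∑' p : ℕ+ × ℕ+, G (p.1 + p.2, p.1)
      + (∑' p : ℕ+ × ℕ+, G (p.1, p.1 + p.2) + ∑' n : ℕ+, G (n, n)) := by
  have hs : Summable (G ∘ pnatProdSplit) := hG.comp_injective pnatProdSplit_bijective.1
  have hr : Summable ((G ∘ pnatProdSplit) ∘ Sum.inr) := hs.comp_injective Sum.inr_injective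
  rw [← (Equiv.ofBijective _ pnatProdSplit_bijective).tsum_eq G]
  exact ((hs.comp_injective Sum.inl_injective).hasSum.sum
    ((hr.comp_injective Sum.inl_injective).hasSum.sum
      (hr.comp_injective Sum.inr_injective).hasSum)).tsum_eq

/-! ### The sum formula for bounded coefficients -/

/-- The sum formula for double `L`-values with an arbitrary bounded sequence `f` in place of the
character: `sum_partial_fractions` times `f x`, summed over `x` and `y`. -/
theorem sum_formula_of_bounded (k : ℕ) (hk : 1 ≤ k) {f : ℕ → ℂ} {C : ℝ} (hf : ∀ n, ‖f n‖ ≤ C) :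
    ∑ ν ∈ Icc 2 (k + 1),
          (ν : ℂ) * ∑' p : ℕ+ × ℕ+, f p.1 * zeta2Term (k + 2 - ν) (ν + 1) p
        + ((k : ℂ) + 1) * ∑' p : ℕ+ × ℕ+, f p.2 * zeta2Term 1 (k + 2) p
        + ∑' p : ℕ+ × ℕ+, f p.2 * zeta2Term 2 (k + 1) p
        - ∑' p : ℕ+ × ℕ+, f (p.1 + p.2) * zeta2Term 2 (k + 1) p
      = ∑' n : ℕ+, f n / ((n : ℕ) : ℂ) ^ (k + 3) := by
  have h1 : ∀ ν ∈ Icc 2 (k + 1),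
      Summable fun p : ℕ+ × ℕ+ => (ν : ℂ) * (f p.1 * zeta2Term (k + 2 - ν) (ν + 1) p) := by
    intro ν hν
    have := mem_Icc.1 hν
    exact ((summable_zeta2Term (by omega) (by omega)).bounded_mul fun p => hf _).mul_left _
  -- in the second and third sums the pair is swapped, so that `f` is always taken at `p.1`
  have h2 : Summable fun p : ℕ+ × ℕ+ => ((k : ℂ) + 1) * (f p.1 * zeta2Term 1 (k + 2) p.swap) :=
    ((summable_zeta2Term le_rfl (by omega)).prod_symm.bounded_mul
      fun p : ℕ+ × ℕ+ => hf p.1).mul_left _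
  have h3 : Summable fun p : ℕ+ × ℕ+ => f p.1 * zeta2Term 2 (k + 1) p.swap :=
    (summable_zeta2Term (by omega) (by omega)).prod_symm.bounded_mul fun p : ℕ+ × ℕ+ => hf p.1
  have h4 : Summable fun p : ℕ+ × ℕ+ => f p.1 * zeta2Term (k + 1) 2 p :=
    (summable_zeta2Term (by omega) le_rfl).bounded_mul fun p : ℕ+ × ℕ+ => hf p.1
  set G : ℕ+ × ℕ+ → ℂ := fun p =>
    f p.1 * (1 / (((p.1 : ℕ) : ℂ) ^ (k + 1) * ((p.2 : ℕ) : ℂ) ^ 2)) with hGdef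
  have hpt : ∀ p : ℕ+ × ℕ+,
      ∑ ν ∈ Icc 2 (k + 1), (ν : ℂ) * (f p.1 * zeta2Term (k + 2 - ν) (ν + 1) p)
        + ((k : ℂ) + 1) * (f p.1 * zeta2Term 1 (k + 2) p.swap)
        + f p.1 * zeta2Term 2 (k + 1) p.swap + f p.1 * zeta2Term (k + 1) 2 p = G p := by
    rintro ⟨m, n⟩
    have hm : ((m : ℕ) : ℂ) ≠ 0 := by exact_mod_cast m.ne_zero
    have hn : ((n : ℕ) : ℂ) ≠ 0 := by exact_mod_cast n.ne_zero
    have hmn : ((m : ℕ) : ℂ) + ((n : ℕ) : ℂ) ≠ 0 := by exact_mod_cast (m + n).ne_zero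
    have key := congrArg (fun t => f m * t) (sum_partial_fractions k hm hn hmn)
    simp only [mul_add, mul_sub, mul_sum] at key
    simp only [hGdef, zeta2Term, Prod.swap]
    simp only [mul_left_comm _ (f m)]
    linear_combination key
  have h12 := (summable_sum h1).add h2
  have h123 := h12.add h3
  have hG : Summable G := (h123.add h4).congr hpt
  have htot := tsum_congr (L := .unconditional _) hpt
  rw [h123.tsum_add h4, h12.tsum_add h3, (summable_sum h1).tsum_add h2, Summable.tsum_finsetSum h1,
    tsum_pnat_prod_eq hG] at htot
  simp only [tsum_mul_left] at htot
  have hswap : ∀ a b : ℕ, ∑' p : ℕ+ × ℕ+, f p.1 * zeta2Term a b p.swap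
      = ∑' p : ℕ+ × ℕ+, f p.2 * zeta2Term a b p := fun a b =>
    (Equiv.prodComm ℕ+ ℕ+).tsum_eq fun p : ℕ+ × ℕ+ => f p.2 * zeta2Term a b p
  have hbelow : ∑' p : ℕ+ × ℕ+, G (p.1 + p.2, p.1)
      = ∑' p : ℕ+ × ℕ+, f (p.1 + p.2) * zeta2Term 2 (k + 1) p :=
    tsum_congr fun p => by
      simp only [hGdef, zeta2Term, PNat.add_coe, Nat.cast_add]
      rw [mul_comm (((p.1 : ℕ) : ℂ) ^ 2)]
  have habove : ∑' p : ℕ+ × ℕ+, G (p.1, p.1 + p.2)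
      = ∑' p : ℕ+ × ℕ+, f p.1 * zeta2Term (k + 1) 2 p :=
    tsum_congr fun p => by simp only [hGdef, zeta2Term, PNat.add_coe, Nat.cast_add]
  have hdiag : ∑' n : ℕ+, G (n, n) = ∑' n : ℕ+, f n / ((n : ℕ) : ℂ) ^ (k + 3) :=
    tsum_congr fun n => by simp only [hGdef, ← pow_add, mul_one_div]
  rw [hswap, hswap, hbelow, habove, hdiag] at htot
  linear_combination htot

/-! ### Double `L`-series at integers -/

theorem trivChar_apply (a : ZMod 1) : trivChar a = 1 := by
  rw [Subsingleton.elim a 1, map_one]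

theorem L2shTerm_natCast {M N : ℕ} (a b : ℕ) (ψ₁ : DirichletCharacter ℂ M)
    (ψ₂ : DirichletCharacter ℂ N) (p : ℕ+ × ℕ+) :
    L2shTerm a b ψ₁ ψ₂ p = ψ₁ (p.1 : ℕ) * ψ₂ (p.2 : ℕ) * zeta2Term a b p := by
  simp only [L2shTerm, zeta2Term, Complex.cpow_natCast, mul_one_div]

theorem L2astTerm_natCast {M N : ℕ} (a b : ℕ) (ψ₁ : DirichletCharacter ℂ M)
    (ψ₂ : DirichletCharacter ℂ N) (p : ℕ+ × ℕ+) :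
    L2astTerm a b ψ₁ ψ₂ p
      = ψ₁ (p.1 : ℕ) * ψ₂ ((p.1 + p.2 : ℕ) : ZMod N) * zeta2Term a b p := by
  simp only [L2astTerm, zeta2Term, Complex.cpow_natCast, mul_one_div]

theorem L2shTerm_trivChar_right {N : ℕ} (a b : ℕ) (χ : DirichletCharacter ℂ N) :
    L2shTerm a b χ trivChar = fun p => χ (p.1 : ℕ) * zeta2Term a b p := by
  ext p
  rw [L2shTerm_natCast, trivChar_apply, mul_one]

theorem L2shTerm_trivChar_left {N : ℕ} (a b : ℕ) (χ : DirichletCharacter ℂ N) :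
    L2shTerm a b trivChar χ = fun p => χ (p.2 : ℕ) * zeta2Term a b p := by
  ext p
  rw [L2shTerm_natCast, trivChar_apply, one_mul]

theorem L2astTerm_trivChar_left {N : ℕ} (a b : ℕ) (χ : DirichletCharacter ℂ N) :
    L2astTerm a b trivChar χ = fun p => χ ((p.1 + p.2 : ℕ) : ZMod N) * zeta2Term a b p := by
  ext p
  rw [L2astTerm_natCast, trivChar_apply, one_mul]

theorem LSeries_natCast_eq_tsum_pnat (f : ℕ → ℂ) (s : ℕ) :
    LSeries f s = ∑' n : ℕ+, f n / ((n : ℕ) : ℂ) ^ s := by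
  rw [LSeries, ← tsum_pnat_eq_tsum_of_eq_zero (LSeries.term_zero f s)]
  exact tsum_congr fun n => by
    rw [LSeries.term_of_ne_zero n.ne_zero, Complex.cpow_natCast]

theorem corollary1p5 (k : ℕ) (hk : 1 ≤ k) :
    (∀ (N : ℕ) [NeZero N] (χ : DirichletCharacter ℂ N),
      -- all the series involved converge absolutely
      (∀ ν ∈ Icc 2 (k + 1),
        Summable (L2shTerm ((k : ℂ) + 2 - (ν : ℂ)) ((ν : ℂ) + 1) χ trivChar)) ∧
      Summable (L2shTerm 1 ((k : ℂ) + 2) trivChar χ) ∧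
      Summable (L2shTerm 2 ((k : ℂ) + 1) trivChar χ) ∧
      Summable (L2astTerm 2 ((k : ℂ) + 1) trivChar χ) ∧
      LSeriesSummable (fun n : ℕ => χ (n : ZMod N)) ((k : ℂ) + 3) ∧
      -- the sum formula for double `L`-values
      ∑ ν ∈ Icc 2 (k + 1),
          (ν : ℂ) * L2sh ((k : ℂ) + 2 - (ν : ℂ)) ((ν : ℂ) + 1) χ trivChar
        + ((k : ℂ) + 1) * L2sh 1 ((k : ℂ) + 2) trivChar χ
        + L2sh 2 ((k : ℂ) + 1) trivChar χ
        - L2ast 2 ((k : ℂ) + 1) trivChar χ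
        = LSeries (fun n : ℕ => χ (n : ZMod N)) ((k : ℂ) + 3)) ∧
    -- the sum formula for double zeta values
    (∀ ν ∈ Icc 2 k, Summable (zeta2Term (k + 2 - ν) (ν + 1))) ∧
    Summable (zeta2Term 1 (k + 2)) ∧
    ∑ ν ∈ Icc 2 k, (ν : ℂ) * zeta2 (k + 2 - ν) (ν + 1) + 2 * ((k : ℂ) + 1) * zeta2 1 (k + 2)
      = riemannZeta ((k : ℂ) + 3) := by
  refine ⟨fun N _ χ => ?_, fun ν hν => ?_, summable_zeta2Term le_rfl (by omega), ?_⟩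
  · have hf : ∀ n : ℕ, ‖χ (n : ZMod N)‖ ≤ 1 := fun n => χ.norm_le_one _
    have hterm : ∀ ν ∈ Icc 2 (k + 1), L2shTerm ((k : ℂ) + 2 - (ν : ℂ)) ((ν : ℂ) + 1) χ trivChar
        = fun p => χ (p.1 : ℕ) * zeta2Term (k + 2 - ν) (ν + 1) p := fun ν hν => by
      rw [← L2shTerm_trivChar_right, Nat.cast_sub (by have := mem_Icc.1 hν; omega)]
      push_cast
      rfl
    have hterm₁ : L2shTerm 1 ((k : ℂ) + 2) trivChar χ
        = fun p => χ (p.2 : ℕ) * zeta2Term 1 (k + 2) p := by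
      rw [← L2shTerm_trivChar_left]
      push_cast
      rfl
    have hterm₂ : L2shTerm 2 ((k : ℂ) + 1) trivChar χ
        = fun p => χ (p.2 : ℕ) * zeta2Term 2 (k + 1) p := by
      rw [← L2shTerm_trivChar_left]
      push_cast
      rfl
    have hterm₃ : L2astTerm 2 ((k : ℂ) + 1) trivChar χ
        = fun p => χ ((p.1 + p.2 : ℕ) : ZMod N) * zeta2Term 2 (k + 1) p := by
      rw [← L2astTerm_trivChar_left]
      push_cast
      rfl
    refine ⟨fun ν hν => ?_, ?_, ?_, ?_, ?_, ?_⟩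
    · have := mem_Icc.1 hν
      rw [hterm ν hν]
      exact (summable_zeta2Term (by omega) (by omega)).bounded_mul fun p => hf p.1
    · rw [hterm₁]
      exact (summable_zeta2Term le_rfl (by omega)).bounded_mul fun p => hf p.2
    · rw [hterm₂]
      exact (summable_zeta2Term (by omega) (by omega)).bounded_mul fun p => hf p.2
    · rw [hterm₃]
      exact (summable_zeta2Term (by omega) (by omega)).bounded_mul fun p => hf (p.1 + p.2)
    · refine LSeriesSummable_of_bounded_of_one_lt_re (fun n _ => hf n) ?_
      norm_cast
      omega
    · have hL := LSeries_natCast_eq_tsum_pnat (fun n => χ (n : ZMod N)) (k + 3)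
      push_cast at hL
      rw [hL, ← sum_formula_of_bounded k hk hf, L2sh, L2sh, L2ast, hterm₁, hterm₂, hterm₃,
        sum_congr rfl fun ν hν => by rw [L2sh, hterm ν hν]]
  · have := mem_Icc.1 hν
    exact summable_zeta2Term (by omega) (by omega)
  · have h := sum_formula_of_bounded k hk (f := 1) (C := 1) fun n => by simp
    have hL := LSeries_natCast_eq_tsum_pnat 1 (k + 3)
    rw [← hL, Nat.cast_add, Nat.cast_ofNat,
      LSeries_one_eq_riemannZeta (by norm_cast; omega)] at h
    simp only [Pi.one_apply, one_mul] at h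
    rw [sum_Icc_succ_top (by omega), show k + 2 - (k + 1) = 1 by omega] at h
    push_cast at h
    simp only [zeta2]
    linear_combination h
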